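/- Let $n\ge 2$ and let $G$ be a connected threshold graph with vertices $v_1,\dots,v_n$, ordered so that whenever $\{v_j,v_\ell\}\in E(G)$ with $j<\ell$, then $\{v_i,v_\ell\}\in E(G)$ for all $i<j$ and $\{v_j,v_k\}\in E(G)$ for all $k<\ell$ with $k\ne j$. Let $\delta_i=\deg(v_i)$, and let $t$ be the largest index such that $\{v_i,v_j\}\in E(G)$ for all $1\le i<j\le t$. Let $x_1,\dots,x_n,y_1,\dots,y_n$ be indeterminates (over any commutative ring), weight the edge $\{v_i,v_j\}$ of $G$ by $\omega_{i,j}=x_{\min(i,j)}\,y_{\max(i,j)}$, and let $$\tau(G;\omega)=\sum_{T\in\mathcal{ST}(G)}\ \prod_{\{v_i,v_j\}\in E(T)}\omega_{i,j},$$ where $\mathcal{ST}(G)$ is the set of spanning trees of $G$. For a spanning tree $T$, let $\operatorname{indeg}_T$ and $\operatorname{outdeg}_T$ denote the indegree and outdegree in $T$ when every edge is oriented from its higher-indexed to its lower-indexed endpoint. Then $$\tau(G;\omega)=\sum_{T\in\mathcal{ST}(G)}\ \prod_{i=1}^n x_i^{\operatorname{indeg}_T(v_i)}\,y_i^{\operatorname{outdeg}_T(v_i)}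 = x_1\Big(\prod_{i=t}^n y_i\Big)\Big(\prod_{j=2}^{t-1} f_j\Big)\Big(\prod_{j=t+1}^n g_j\Big),$$ where $$f_j=y_j\sum_{i=1}^{j}x_i+x_j\sum_{k=j+1}^{1+\delta_j}y_k,\qquad g_j=\sum_{i=1}^{\delta_j}x_i .$$ -/

import Mathlib

open scoped BigOperators

namespace ThresholdTree

open scoped Classical in
/-- The spanning trees of `G`: the trees on the full vertex set all of whose edges are edges
of `G`. -/
noncomputable def spanningTrees {V : Type*} [Fintype V] (G : SimpleGraph V) :
    Finset (SimpleGraph V) :=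
  Finset.univ.filter fun T => T ≤ G ∧ T.IsTree

open scoped Classical in
/-- The weighted spanning tree enumerator of `G` with edge weights `ω`. -/
noncomputable def treeEnumerator {V A : Type*} [Fintype V] [CommRing A]
    (G : SimpleGraph V) (ω : Sym2 V → A) : A :=
  ∑ T ∈ spanningTrees G, ∏ e ∈ T.edgeFinset, ω e

/-- The enumeration `v` of the vertices exhibits `G` as a threshold graph. -/
def IsThresholdOrdering {V : Type*} {n : ℕ} (G : SimpleGraph V) (v : Fin n ≃ V) : Prop :=
  ∀ j l : Fin n, j < l → G.Adj (v j) (v l) →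
    (∀ i, i < j → G.Adj (v i) (v l)) ∧ (∀ k, k < l → k ≠ j → G.Adj (v j) (v k))

/-- `v t` is the special vertex: `t` is the largest index such that the vertices
up to `v t` are pairwise adjacent. -/
def IsSpecialIndex {V : Type*} {n : ℕ} (G : SimpleGraph V) (v : Fin n ≃ V) (t : Fin n) : Prop :=
  IsGreatest {s : Fin n | ∀ i j : Fin n, i < j → j ≤ s → G.Adj (v i) (v j)} t

/-- The edge weighting with weight `x_{min(i,j)} y_{max(i,j)}` on the pair `{v i, v j}`. -/
def minMaxWeight {V A : Type*} [CommRing A] {n : ℕ} (v : Fin n ≃ V) (x y : Fin n → A)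
    (e : Sym2 V) : A :=
  x (e.map v.symm).inf * y (e.map v.symm).sup

/-- Indegree of `v i` in `T`, edges being oriented from the higher to the lower index. -/
noncomputable def indeg {V : Type*} {n : ℕ} (T : SimpleGraph V) (v : Fin n ≃ V) (i : Fin n) : ℕ :=
  {j : Fin n | i < j ∧ T.Adj (v i) (v j)}.ncard

/-- Outdegree of `v i` in `T`, edges being oriented from the higher to the lower index. -/
noncomputable def outdeg {V : Type*} {n : ℕ} (T : SimpleGraph V) (v : Fin n ≃ V) (i : Fin n) : ℕ :=
  {j : Fin n | j < i ∧ T.Adj (v i) (v j)}.ncard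

/-- `f_j = y_j ∑_{i ≤ j} x_i + x_j ∑_{k = j+1}^{1+δ_j} y_k`. Indices in `Fin n` start at `0`, so
the upper bound `1 + δ_j` of the second sum becomes `δ_j`. -/
def fFactor {A : Type*} [CommRing A] {n : ℕ} (δ : Fin n → ℕ) (x y : Fin n → A) (j : Fin n) : A :=
  y j * ∑ i ∈ Finset.Iic j, x i + x j * ∑ k : Fin n with j < k ∧ k.val ≤ δ j, y k

/-- `g_j = ∑_{i=1}^{δ_j} x_i`, the sum of the first `δ_j` of the `x_i`. -/
def gFactor {A : Type*} [CommRing A] {n : ℕ} (δ : Fin n → ℕ) (x : Fin n → A) (j : Fin n) : A :=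
  ∑ i : Fin n with i.val < δ j, x i

end ThresholdTree

open ThresholdTree

namespace ThresholdTree

section ParentFunctions

variable {V : Type*} {r : V}

/-- A parent function is ranked if following parents strictly decreases some height function;
on a finite type, this says that all vertices lead to the root. -/
def IsRanked (f : {i : V // i ≠ r} → V) : Prop :=
  ∃ h : V → ℕ, ∀ i : {i : V // i ≠ r}, h (f i) < h i

/-- The graph joining every nonroot vertex to its parent. -/
def parentGraph (f : {i : V // i ≠ r} → V) : SimpleGraph V :=
  SimpleGraph.fromEdgeSet (Set.range fun i : {i : V // i ≠ r} => s((i : V), f i))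

open scoped Classical in
/-- If no height function exists, then some nonempty set of nonroot vertices is preserved
by taking parents and by taking children. -/
lemma exists_invariant_set_of_not_isRanked {f : {i : V // i ≠ r} → V} (hf : ¬ IsRanked f) :
    ∃ C : Set V, r ∉ C ∧ C.Nonempty ∧ ∀ i : {i : V // i ≠ r}, i.1 ∈ C ↔ f i ∈ C := by
  let g : V → V := fun i => if hi : i ≠ r then f ⟨i, hi⟩ else r
  have hg : ∀ i : {i : V // i ≠ r}, g i = f i := fun i => by simp [g, i.2]
  have key : ∀ i : {i : V // i ≠ r}, (∃ k, g^[k] i = r) ↔ ∃ k, g^[k] (f i) = r := by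
    intro i
    constructor
    · rintro ⟨k, hk⟩
      cases k with
      | zero => exact absurd hk i.2
      | succ k => exact ⟨k, by rw [Function.iterate_succ_apply, hg] at hk; exact hk⟩
    · rintro ⟨k, hk⟩
      exact ⟨k + 1, by rw [Function.iterate_succ_apply, hg]; exact hk⟩
  refine ⟨{i | ¬ ∃ k, g^[k] i = r}, fun h => h ⟨0, rfl⟩, ?_, fun i => not_congr (key i)⟩
  by_contra hne
  have hall : ∀ i, ∃ k, g^[k] i = r := by
    intro i
    by_contra hi
    exact hne ⟨i, hi⟩
  refine hf ⟨fun i => Nat.find (hall i), fun i => ?_⟩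
  beta_reduce
  have hs := Nat.find_spec (hall i)
  rcases hk : Nat.find (hall i) with _ | k
  · rw [hk] at hs
    exact absurd hs i.2
  · rw [hk, Function.iterate_succ_apply, hg] at hs
    exact Nat.lt_succ_of_le (Nat.find_min' (hall (f i)) hs)

variable [Fintype V] [DecidableEq V]

/-- The matrix `1 - A`, where `A` is the matrix of a parent function with the root deleted. -/
def parentMatrix (A : Type*) [CommRing A] (f : {i : V // i ≠ r} → V) :
    Matrix {i : V // i ≠ r} {i : V // i ≠ r} A :=
  Matrix.of fun i j => (if i = j then 1 else 0) - (if f i = j then 1 else 0)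

variable {A : Type*} [CommRing A]

lemma det_parentMatrix_of_isRanked {f : {i : V // i ≠ r} → V} (hf : IsRanked f) :
    (parentMatrix A f).det = 1 := by
  obtain ⟨h, hh⟩ := hf
  have hne : ∀ i, f i ≠ i := fun i hi => (hh i).ne (by rw [hi])
  have hT : (parentMatrix A f).BlockTriangular fun i => OrderDual.toDual (h i) := by
    intro i j hij
    have hij' : h i < h j := hij
    have h1 : i ≠ j := by rintro rfl; exact lt_irrefl _ hij'
    have h2 : f i ≠ j := fun e => by have := hh i; rw [e] at this; omega
    simp [parentMatrix, h1, h2]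
  rw [hT.det]
  refine Finset.prod_eq_one fun k _ => ?_
  have : (parentMatrix A f).toSquareBlock (fun i => OrderDual.toDual (h i)) k = 1 := by
    ext i j
    have h2 : f i.1 ≠ j.1 := fun e => by
      have h3 := hh i.1
      rw [e] at h3
      have h4 : h i.1 = h j.1 := OrderDual.toDual.injective (i.2.trans j.2.symm)
      omega
    simp [parentMatrix, Matrix.toSquareBlock_def, h2, Matrix.one_apply, Subtype.ext_iff]
  rw [this, Matrix.det_one]

lemma det_parentMatrix_of_not_isRanked {f : {i : V // i ≠ r} → V} (hf : ¬ IsRanked f) :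
    (parentMatrix A f).det = 0 := by
  classical
  obtain ⟨C, hr, ⟨a, ha⟩, hC⟩ := exists_invariant_set_of_not_isRanked hf
  let u : {i : V // i ≠ r} → A := fun i => if (i : V) ∈ C then 1 else 0
  have hu : (parentMatrix A f).mulVec u = 0 := by
    ext i
    have h2 : ∑ j : {i : V // i ≠ r}, (if f i = j then u j else 0) =
        if f i ∈ C then 1 else 0 := by
      by_cases hfi : f i = r
      · rw [hfi, if_neg hr]
        exact Finset.sum_eq_zero fun j _ => if_neg j.2.symm
      · rw [Finset.sum_eq_single ⟨f i, hfi⟩]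
        · simp [u]
        · intro j _ hj
          exact if_neg fun e => hj (Subtype.ext e.symm)
        · simp
    simp only [parentMatrix, Matrix.mulVec, dotProduct, Matrix.of_apply, sub_mul, ite_mul, one_mul,
      zero_mul, Finset.sum_sub_distrib, h2, Finset.sum_ite_eq, Finset.mem_univ, if_true,
      Pi.zero_apply]
    simp [u, hC i]
  have h3 : (parentMatrix A f).adjugate.mulVec ((parentMatrix A f).mulVec u) = 0 := by
    rw [hu, Matrix.mulVec_zero]
  rw [Matrix.mulVec_mulVec, Matrix.adjugate_mul] at h3
  have h4 := congrFun h3 ⟨a, fun e => hr (e ▸ ha)⟩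
  simpa [Matrix.smul_mulVec, u, ha] using h4

/-- The weighted Laplacian with the row and column of the root deleted. -/
def reducedLaplacian (r : V) (w : V → V → A) : Matrix {i : V // i ≠ r} {i : V // i ≠ r} A :=
  Matrix.of fun i j => (if i = j then ∑ k, w i k else 0) - w i j

open scoped Classical in
/-- The all-functions expansion of the reduced Laplacian determinant. -/
lemma det_reducedLaplacian_eq_sum_isRanked (r : V) (w : V → V → A) :
    (reducedLaplacian r w).det =
      ∑ f : {i : V // i ≠ r} → V with IsRanked f, ∏ i : {i : V // i ≠ r}, w i (f i) := by
  have hrow : reducedLaplacian r w = fun i : {i : V // i ≠ r} => ∑ k : V, w i k •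
      fun j : {i : V // i ≠ r} => (if i = j then (1 : A) else 0) - (if k = j then 1 else 0) := by
    ext i j
    simp only [reducedLaplacian, Matrix.of_apply, Finset.sum_apply, Pi.smul_apply, smul_eq_mul,
      mul_sub, Finset.sum_sub_distrib, mul_ite, mul_one, mul_zero, Finset.sum_ite_eq',
      Finset.mem_univ, if_true]
    split_ifs <;> simp
  have hexp := (Matrix.detRowAlternating (R := A)
    (n := {i : V // i ≠ r})).toMultilinearMap.map_sum (fun (i : {i : V // i ≠ r}) (k : V) => w i k •
      fun j : {i : V // i ≠ r} => (if i = j then (1 : A) else 0) - (if k = j then 1 else 0))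
  rw [hrow]
  refine hexp.trans ?_
  rw [Finset.sum_filter]
  refine Finset.sum_congr rfl fun f _ => ?_
  rw [MultilinearMap.map_smul_univ]
  change (∏ i : {i : V // i ≠ r}, w i (f i)) • (parentMatrix A f).det = _
  split_ifs with hf
  · rw [det_parentMatrix_of_isRanked hf, smul_eq_mul, mul_one]
  · rw [det_parentMatrix_of_not_isRanked hf, smul_zero]


end ParentFunctions
section TreeBijection

variable {V : Type*} {r : V}

lemma IsRanked.ne {f : {i : V // i ≠ r} → V} (hf : IsRanked f) (i : {i : V // i ≠ r}) :
    (i : V) ≠ f i := by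
  obtain ⟨h, hh⟩ := hf
  exact fun e => (hh i).ne (by rw [← e])

lemma IsRanked.parentGraph_adj {f : {i : V // i ≠ r} → V} (hf : IsRanked f)
    (i : {i : V // i ≠ r}) : (parentGraph f).Adj i (f i) := by
  rw [parentGraph, SimpleGraph.fromEdgeSet_adj]
  exact ⟨⟨i, rfl⟩, hf.ne i⟩

lemma IsRanked.edgeSet_parentGraph {f : {i : V // i ≠ r} → V} (hf : IsRanked f) :
    (parentGraph f).edgeSet = Set.range fun i : {i : V // i ≠ r} => s((i : V), f i) := by
  rw [parentGraph, SimpleGraph.edgeSet_fromEdgeSet, sdiff_eq_left, Set.disjoint_left]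
  rintro _ ⟨i, rfl⟩ h
  exact hf.ne i (by simpa using h)

lemma IsRanked.injective_edge {f : {i : V // i ≠ r} → V} (hf : IsRanked f) :
    Function.Injective fun i : {i : V // i ≠ r} => s((i : V), f i) := by
  obtain ⟨h, hh⟩ := hf
  intro i j hij
  rcases Sym2.eq_iff.1 hij with ⟨h1, -⟩ | ⟨h1, h2⟩
  · exact Subtype.ext h1
  · have hi := hh i
    have hj := hh j
    rw [h2] at hi
    rw [← h1] at hj
    omega

lemma IsRanked.connected_parentGraph {f : {i : V // i ≠ r} → V} (hf : IsRanked f) :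
    (parentGraph f).Connected := by
  obtain ⟨h, hh⟩ := id hf
  have key : ∀ n i, h i = n → (parentGraph f).Reachable i r := by
    intro n
    induction n using Nat.strong_induction_on with
    | _ n ih =>
      intro i hi
      by_cases hir : i = r
      · rw [hir]
      · have h1 := hh ⟨i, hir⟩
        exact (hf.parentGraph_adj ⟨i, hir⟩).reachable.trans (ih _ (hi ▸ h1) _ rfl)
  have : Nonempty V := ⟨r⟩
  exact ⟨fun i j => (key _ i rfl).trans (key _ j rfl).symm⟩

lemma IsRanked.isTree_parentGraph [Finite V] {f : {i : V // i ≠ r} → V} (hf : IsRanked f) :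
    (parentGraph f).IsTree := by
  classical
  have := Fintype.ofFinite V
  rw [SimpleGraph.isTree_iff_connected_and_card]
  refine ⟨hf.connected_parentGraph, ?_⟩
  have hpos : 0 < Fintype.card V := Fintype.card_pos_iff.2 ⟨r⟩
  rw [hf.edgeSet_parentGraph, Nat.card_range_of_injective hf.injective_edge,
    Nat.card_eq_fintype_card, Nat.card_eq_fintype_card, Fintype.card_subtype_compl,
    Fintype.card_subtype_eq]
  omega

lemma IsRanked.eq_of_parentGraph_eq {f g : {i : V // i ≠ r} → V} (hf : IsRanked f)
    (hg : IsRanked g) (hfg : parentGraph f = parentGraph g) : f = g := by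
  obtain ⟨h, hh⟩ := id hg
  have step : ∀ i, f i ≠ g i → ∃ j : {i : V // i ≠ r}, g i = j ∧ f j = i := by
    intro i hi
    have h1 := hg.parentGraph_adj i
    rw [← hfg, ← SimpleGraph.mem_edgeSet, hf.edgeSet_parentGraph] at h1
    obtain ⟨j, hj⟩ := h1
    rcases Sym2.eq_iff.1 hj with ⟨h2, h3⟩ | ⟨h2, h3⟩
    · obtain rfl := Subtype.ext h2
      exact absurd h3 hi
    · exact ⟨j, h2.symm, h3⟩
  have key : ∀ n (i : {i : V // i ≠ r}), h i = n → f i = g i := by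
    intro n
    induction n using Nat.strong_induction_on with
    | _ n ih =>
      intro i hi
      by_contra hne
      obtain ⟨j, h1, h2⟩ := step i hne
      have h3 := hh i
      rw [h1, hi] at h3
      have h4 := ih _ h3 j rfl
      have h5 := hh j
      rw [← h4, h2] at h5
      omega
  exact funext fun i => key _ i rfl

lemma exists_isRanked_of_isTree [Finite V] {T : SimpleGraph V} (hT : T.IsTree) (r : V) :
    ∃ f : {i : V // i ≠ r} → V, IsRanked f ∧ parentGraph f = T := by
  classical
  have := Fintype.ofFinite V
  have step : ∀ i : {i : V // i ≠ r}, ∃ j, T.Adj i j ∧ T.dist j r < T.dist i r := by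
    rintro ⟨i, hi⟩
    obtain ⟨p, hp⟩ := hT.connected.exists_walk_length_eq_dist i r
    cases p with
    | nil => exact absurd rfl hi
    | cons hadj q =>
      refine ⟨_, hadj, ?_⟩
      change _ < T.dist i r
      have := SimpleGraph.dist_le q
      rw [SimpleGraph.Walk.length_cons] at hp
      omega
  choose f hadj hdist using step
  have hf : IsRanked f := ⟨fun i => T.dist i r, hdist⟩
  refine ⟨f, hf, ?_⟩
  have hle : parentGraph f ≤ T := by
    rw [← SimpleGraph.edgeSet_subset_edgeSet, hf.edgeSet_parentGraph]
    rintro _ ⟨i, rfl⟩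
    exact hadj i
  have hmin := SimpleGraph.isTree_iff_minimal_connected.1 hT
  exact le_antisymm hle (hmin.2 hf.connected_parentGraph hle)

variable [Fintype V] [DecidableEq V] {A : Type*} [CommRing A]

open scoped Classical in
/-- The weighted matrix-tree theorem. -/
theorem treeEnumerator_eq_det (G : SimpleGraph V) (ω : Sym2 V → A) (r : V) :
    treeEnumerator G ω =
      (reducedLaplacian r fun i j => if G.Adj i j then ω s(i, j) else 0).det := by
  rw [det_reducedLaplacian_eq_sum_isRanked, treeEnumerator]
  symm
  have hzero : ∀ f : {i : V // i ≠ r} → V, IsRanked f → ¬ parentGraph f ≤ G →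
      ∏ i : {i : V // i ≠ r}, (if G.Adj i (f i) then ω s((i : V), f i) else 0) = 0 := by
    intro f hf hG
    rw [← SimpleGraph.edgeSet_subset_edgeSet, hf.edgeSet_parentGraph, Set.range_subset_iff] at hG
    push Not at hG
    obtain ⟨i, hi⟩ := hG
    exact Finset.prod_eq_zero (Finset.mem_univ i) (if_neg hi)
  rw [← Finset.sum_filter_of_ne (p := fun f => parentGraph f ≤ G)
    fun f hf hne => by_contra fun h => hne (hzero f (Finset.mem_filter.1 hf).2 h)]
  refine Finset.sum_bij (fun f _ => parentGraph f) ?_ ?_ ?_ ?_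
  · intro f hf
    simp only [Finset.mem_filter, Finset.mem_univ, true_and] at hf
    simp only [spanningTrees, Finset.mem_filter, Finset.mem_univ, true_and]
    exact ⟨hf.2, hf.1.isTree_parentGraph⟩
  · intro f hf g hg hfg
    simp only [Finset.mem_filter, Finset.mem_univ, true_and] at hf hg
    exact hf.1.eq_of_parentGraph_eq hg.1 hfg
  · intro T hT
    simp only [spanningTrees, Finset.mem_filter, Finset.mem_univ, true_and] at hT
    obtain ⟨f, hf, rfl⟩ := exists_isRanked_of_isTree hT.2 r
    exact ⟨f, by simp [hf, hT.1], rfl⟩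
  · intro f hf
    simp only [Finset.mem_filter, Finset.mem_univ, true_and] at hf
    have himg : (parentGraph f).edgeFinset =
        Finset.univ.image fun i : {i : V // i ≠ r} => s((i : V), f i) := by
      ext e
      rw [SimpleGraph.mem_edgeFinset, hf.1.edgeSet_parentGraph]
      simp
    rw [himg, Finset.prod_image fun i _ j _ h => hf.1.injective_edge h]
    exact Finset.prod_congr rfl fun i _ => if_pos (hf.2 (hf.1.parentGraph_adj i))

end TreeBijection
section ShiftedDeterminant

/-- The sequence of lower degrees of a connected threshold graph on `{0, …, n - 1}`, in which the
lower neighbours of `k` are the vertices `i < c k`. -/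
structure IsLowerDegree (c : ℕ → ℕ) (n : ℕ) : Prop where
  pos : ∀ k, 1 ≤ k → k < n → 1 ≤ c k
  le : ∀ k, k < n → c k ≤ k
  min_le : ∀ k l, k < l → l < n → min (c l) k ≤ c k

lemma IsLowerDegree.mono {c : ℕ → ℕ} {m n : ℕ} (hc : IsLowerDegree c n) (h : m ≤ n) :
    IsLowerDegree c m :=
  ⟨fun k h1 h2 => hc.pos k h1 (h2.trans_le h), fun k h2 => hc.le k (h2.trans_le h),
    fun k l h1 h2 => hc.min_le k l h1 (h2.trans_le h)⟩

variable {A : Type*} [CommRing A]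

/-- The edge weight `x_{min} y_{max}`, restricted to the edges given by the lower degrees `c`. -/
def shiftedWeight (c : ℕ → ℕ) (x y : ℕ → A) (i j : ℕ) : A :=
  if min i j < c (max i j) then x (min i j) * y (max i j) else 0

/-- The Laplacian on the vertices `0, …, m` with the vertex `0` deleted. -/
def shiftedLaplacian (c : ℕ → ℕ) (x y : ℕ → A) (m : ℕ) : Matrix (Fin m) (Fin m) A :=
  Matrix.of fun a b =>
    (if a = b then ∑ k ∈ Finset.range (m + 1), shiftedWeight c x y (a + 1) k else 0) -
      shiftedWeight c x y (a + 1) (b + 1)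

/-- The factor `f_j` for a graph on `{0, …, n - 1}` with lower degrees `c`. -/
def shiftedFactor (c : ℕ → ℕ) (x y : ℕ → A) (n j : ℕ) : A :=
  y j * ∑ i ∈ Finset.range (j + 1), x i +
    x j * ∑ k ∈ Finset.Ico (j + 1) n, if j < c k then y k else 0

variable {K : Type*} [Field K] {c : ℕ → ℕ} {x y : ℕ → K} {m : ℕ}

/-- The variables `y` after elimination of the vertex `l`. -/
def eliminated (c : ℕ → ℕ) (x y : ℕ → K) (l k : ℕ) : K :=
  if k < c l then y k + x k * y l / ∑ i ∈ Finset.range (c l), x i else y k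

lemma shiftedWeight_self (hc : IsLowerDegree c (m + 1)) {i : ℕ} (hi : i ≤ m) (y : ℕ → A)
    (x : ℕ → A) : shiftedWeight c x y i i = 0 := by
  have := hc.le i (by omega)
  rw [shiftedWeight, min_self, max_self, if_neg (by omega)]

lemma shiftedWeight_comm (c : ℕ → ℕ) (x y : ℕ → A) (i j : ℕ) :
    shiftedWeight c x y i j = shiftedWeight c x y j i := by
  rw [shiftedWeight, shiftedWeight, min_comm, max_comm]

lemma shiftedWeight_eliminated_of_lt (hc : IsLowerDegree c (m + 2)) {i j : ℕ} (hij : i < j)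
    (hj : j ≤ m) :
    shiftedWeight c x (eliminated c x y (m + 1)) i j = shiftedWeight c x y i j +
      (if i < c (m + 1) then x i else 0) * (if j < c (m + 1) then x j else 0) * y (m + 1) /
        ∑ k ∈ Finset.range (c (m + 1)), x k := by
  have h := hc.min_le j (m + 1) (by omega) (by omega)
  simp only [shiftedWeight, min_eq_left hij.le, max_eq_right hij.le, eliminated]
  by_cases h1 : j < c (m + 1)
  · rw [if_pos (by omega), if_pos h1, if_pos (by omega), if_pos (by omega), if_pos h1]
    ring
  · simp [h1]

lemma shiftedWeight_eliminated (hc : IsLowerDegree c (m + 2)) {i j : ℕ} (hij : i ≠ j)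
    (hi : i ≤ m) (hj : j ≤ m) :
    shiftedWeight c x (eliminated c x y (m + 1)) i j = shiftedWeight c x y i j +
      (if i < c (m + 1) then x i else 0) * (if j < c (m + 1) then x j else 0) * y (m + 1) /
        ∑ k ∈ Finset.range (c (m + 1)), x k := by
  rcases lt_or_gt_of_ne hij with h | h
  · exact shiftedWeight_eliminated_of_lt hc h hj
  · rw [shiftedWeight_comm, shiftedWeight_eliminated_of_lt hc h hi, shiftedWeight_comm]
    ring

lemma sum_range_ite_lt (x : ℕ → A) {d n : ℕ} (h : d ≤ n) :
    ∑ k ∈ Finset.range n, (if k < d then x k else 0) = ∑ k ∈ Finset.range d, x k := by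
  rw [← Finset.sum_filter]
  congr 1
  ext k
  simp only [Finset.mem_filter, Finset.mem_range]
  omega

lemma sum_shiftedWeight_eliminated (hc : IsLowerDegree c (m + 2))
    (hg : ∑ k ∈ Finset.range (c (m + 1)), x k ≠ 0) {i : ℕ} (hi : i ≤ m) :
    ∑ k ∈ Finset.range (m + 1), shiftedWeight c x (eliminated c x y (m + 1)) i k +
      (if i < c (m + 1) then x i else 0) * (if i < c (m + 1) then x i else 0) * y (m + 1) /
        ∑ k ∈ Finset.range (c (m + 1)), x k =
      ∑ k ∈ Finset.range (m + 2), shiftedWeight c x y i k := by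
  have hd : c (m + 1) ≤ m + 1 := hc.le _ (by omega)
  have hmem : i ∈ Finset.range (m + 1) := Finset.mem_range.2 (by omega)
  have hlast : shiftedWeight c x y i (m + 1) =
      (if i < c (m + 1) then x i else 0) * y (m + 1) := by
    simp only [shiftedWeight, min_eq_left (show i ≤ m + 1 by omega),
      max_eq_right (show i ≤ m + 1 by omega), ite_mul, zero_mul]
  rw [Finset.sum_range_succ _ (m + 1), hlast, ← Finset.add_sum_erase _ _ hmem,
    ← Finset.add_sum_erase _ (fun k => shiftedWeight c x y i k) hmem,
    shiftedWeight_self (hc.mono (by omega)) hi, shiftedWeight_self (hc.mono (by omega)) hi,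
    Finset.sum_congr rfl fun k hk => shiftedWeight_eliminated hc
      (Finset.ne_of_mem_erase hk).symm hi (by
        have := Finset.mem_range.1 (Finset.mem_of_mem_erase hk); omega),
    Finset.sum_add_distrib, ← Finset.sum_div, ← Finset.sum_mul, ← Finset.mul_sum]
  have hsum := sum_range_ite_lt x hd
  rw [← Finset.add_sum_erase _ _ hmem] at hsum
  rw [eq_sub_of_add_eq' hsum]
  field_simp
  ring

lemma det_shiftedLaplacian_succ (hc : IsLowerDegree c (m + 2))
    (hg : ∑ k ∈ Finset.range (c (m + 1)), x k ≠ 0) :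
    (shiftedLaplacian c x y (m + 1)).det =
      y (m + 1) * (∑ k ∈ Finset.range (c (m + 1)), x k) *
        (shiftedLaplacian c x (eliminated c x y (m + 1)) m).det := by
  set g := ∑ k ∈ Finset.range (c (m + 1)), x k with hgdef
  have hd : c (m + 1) ≤ m + 1 := hc.le _ (by omega)
  let z : ℕ → K := fun i => if i < c (m + 1) then x i else 0
  have hz : ∑ k ∈ Finset.range (m + 1), z k = g := sum_range_ite_lt x hd
  have hlast : ∀ i, i ≤ m → shiftedWeight c x y i (m + 1) = z i * y (m + 1) := by
    intro i hi
    simp only [z, shiftedWeight, min_eq_left (show i ≤ m + 1 by omega),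
      max_eq_right (show i ≤ m + 1 by omega), ite_mul, zero_mul]
  have hdiag : ∀ i ≤ m, ∑ k ∈ Finset.range (m + 2), shiftedWeight c x y i k =
      ∑ k ∈ Finset.range (m + 1), shiftedWeight c x (eliminated c x y (m + 1)) i k +
        z i * z i * y (m + 1) / g := fun i hi => (sum_shiftedWeight_eliminated hc hg hi).symm
  have hoff : ∀ i j, i ≠ j → i ≤ m → j ≤ m →
      shiftedWeight c x (eliminated c x y (m + 1)) i j =
        shiftedWeight c x y i j + z i * z j * y (m + 1) / g :=
    fun i j hij hi hj => shiftedWeight_eliminated hc hij hi hj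
  clear_value z g
  have hfac : (shiftedLaplacian c x y (m + 1)).submatrix finSumFinEquiv finSumFinEquiv =
      Matrix.fromBlocks 1 (Matrix.of fun (a : Fin m) (_ : Fin 1) => -(z (a + 1) * y (m + 1) / g)) 0
          (Matrix.of fun _ _ => y (m + 1)) *
        Matrix.fromBlocks (shiftedLaplacian c x (eliminated c x y (m + 1)) m) 0
          (Matrix.of fun (_ : Fin 1) (b : Fin m) => -z (b + 1)) (Matrix.of fun _ _ => g) := by
    rw [Matrix.fromBlocks_multiply]
    ext a b
    rcases a with a | a <;> rcases b with b | b
    · have ha : (a : ℕ) + 1 ≤ m := a.2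
      have hb : (b : ℕ) + 1 ≤ m := b.2
      by_cases hab : a = b
      · subst hab
        simp [shiftedLaplacian, Matrix.mul_apply, hdiag _ ha,
          shiftedWeight_self (hc.mono (Nat.le_succ _)) ha]
        ring
      · have hab' : (a : ℕ) + 1 ≠ b + 1 := fun h => hab (Fin.ext (by omega))
        simp [shiftedLaplacian, Matrix.mul_apply, hab, hoff _ _ hab' ha hb]
        ring
    · have ha : (a : ℕ) + 1 ≤ m := a.2
      have hne : Fin.castAdd 1 a ≠ Fin.natAdd m b := fun h => by
        have := congrArg Fin.val h
        simp at this
        omega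
      simp [shiftedLaplacian, Matrix.mul_apply, hne, hlast _ ha]
      field_simp
    · have hb : (b : ℕ) + 1 ≤ m := b.2
      have hne : Fin.natAdd m a ≠ Fin.castAdd 1 b := fun h => by
        have := congrArg Fin.val h
        simp at this
        omega
      simp [shiftedLaplacian, Matrix.mul_apply, hne, shiftedWeight_comm c x y (m + 1),
        hlast _ hb]
      ring
    · have ha : (a : ℕ) = 0 := by omega
      obtain rfl : a = b := Subsingleton.elim _ _
      have hs : ∑ k ∈ Finset.range (m + 1), shiftedWeight c x y (m + 1) k = g * y (m + 1) := by
        rw [← hz, Finset.sum_mul]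
        refine Finset.sum_congr rfl fun k hk => ?_
        rw [shiftedWeight_comm, hlast]
        have := Finset.mem_range.1 hk
        omega
      simp [shiftedLaplacian, Matrix.mul_apply, Finset.sum_range_succ _ (m + 1), hs]
      ring
  rw [← Matrix.det_submatrix_equiv_self finSumFinEquiv, hfac, Matrix.det_mul,
    Matrix.det_fromBlocks_zero₂₁, Matrix.det_fromBlocks_zero₁₂, Matrix.det_one]
  simp
  ring

lemma shiftedFactor_eliminated (hc : IsLowerDegree c (m + 2))
    (hg : ∑ k ∈ Finset.range (c (m + 1)), x k ≠ 0) {j : ℕ} (hj : j ≤ m) :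
    shiftedFactor c x (eliminated c x y (m + 1)) (m + 1) j = shiftedFactor c x y (m + 2) j := by
  have hd : c (m + 1) ≤ m + 1 := hc.le _ (by omega)
  rw [shiftedFactor, shiftedFactor, Finset.sum_Ico_succ_top (by omega : j + 1 ≤ m + 1)]
  by_cases hjd : j < c (m + 1)
  · have hsum : ∑ k ∈ Finset.Ico (j + 1) (m + 1),
        (if j < c k then eliminated c x y (m + 1) k else 0) =
        ∑ k ∈ Finset.Ico (j + 1) (m + 1), (if j < c k then y k else 0) +
          (∑ k ∈ Finset.Ico (j + 1) (c (m + 1)), x k) *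
            (y (m + 1) / ∑ k ∈ Finset.range (c (m + 1)), x k) := by
      have hsub : Finset.Ico (j + 1) (c (m + 1)) =
          (Finset.Ico (j + 1) (m + 1)).filter (· < c (m + 1)) := by
        ext k
        simp only [Finset.mem_filter, Finset.mem_Ico]
        omega
      rw [hsub, Finset.sum_filter, Finset.sum_mul, ← Finset.sum_add_distrib]
      refine Finset.sum_congr rfl fun k hk => ?_
      rw [Finset.mem_Ico] at hk
      have h := hc.min_le k (m + 1) (by omega) (by omega)
      by_cases hk2 : k < c (m + 1)
      · rw [if_pos (by omega), if_pos (by omega), if_pos hk2, eliminated, if_pos hk2]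
        ring
      · simp [eliminated, hk2]
    rw [hsum, if_pos hjd, eliminated, if_pos hjd]
    have htot := Finset.sum_range_add_sum_Ico x (show j + 1 ≤ c (m + 1) by omega)
    rw [← eq_sub_iff_add_eq'] at htot
    rw [htot]
    field_simp
    ring
  · rw [if_neg hjd, eliminated, if_neg hjd, add_zero]
    congr 2
    refine Finset.sum_congr rfl fun k hk => ?_
    rw [Finset.mem_Ico] at hk
    rw [show eliminated c x y (m + 1) k = y k from if_neg (by omega)]

lemma det_shiftedLaplacian_eq_prod (hx : ∀ k, 1 ≤ k → ∑ i ∈ Finset.range k, x i ≠ 0)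
    (hc : IsLowerDegree c (m + 1)) :
    (shiftedLaplacian c x y m).det = ∏ j ∈ Finset.Ico 1 (m + 1),
      shiftedFactor c x y (m + 1) j * (∑ i ∈ Finset.range (c j), x i) /
        ∑ i ∈ Finset.range (j + 1), x i := by
  induction m generalizing y with
  | zero => simp
  | succ m ih =>
    have hg := hx _ (hc.pos (m + 1) (by omega) (by omega))
    rw [det_shiftedLaplacian_succ hc hg, ih (hc.mono (by omega)),
      Finset.prod_Ico_succ_top (by omega : 1 ≤ m + 1)]
    have h2 := hx (m + 1 + 1) (by omega)
    rw [Finset.prod_congr rfl fun j hj => by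
      rw [shiftedFactor_eliminated hc hg (by have := (Finset.mem_Ico.1 hj).2; omega)]]
    rw [shiftedFactor.eq_def c x y _ (m + 1)]
    simp only [Finset.Ico_self, Finset.sum_empty, mul_zero, add_zero]
    field_simp

end ShiftedDeterminant
section ClosedForm

variable {A : Type*} [CommRing A]

/-- The product formula for the spanning tree enumerator. -/
def shiftedProduct (c : ℕ → ℕ) (x y : ℕ → A) (n t : ℕ) : A :=
  x 0 * (∏ i ∈ Finset.Ico t n, y i) * (∏ j ∈ Finset.Ico 1 t, shiftedFactor c x y n j) *
    ∏ j ∈ Finset.Ico (t + 1) n, ∑ i ∈ Finset.range (c j), x i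

lemma det_shiftedLaplacian_of_field {K : Type*} [Field K] {c : ℕ → ℕ} {x y : ℕ → K} {m t : ℕ}
    (hx : ∀ k, 1 ≤ k → ∑ i ∈ Finset.range k, x i ≠ 0) (hc : IsLowerDegree c (m + 1))
    (ht0 : 1 ≤ t) (htm : t ≤ m) (hlow : ∀ j, 1 ≤ j → j ≤ t → c j = j)
    (hhigh : ∀ j, t < j → j ≤ m → c j ≤ t) :
    (shiftedLaplacian c x y m).det = shiftedProduct c x y (m + 1) t := by
  have hf : ∀ j, t ≤ j → shiftedFactor c x y (m + 1) j =
      y j * ∑ i ∈ Finset.range (j + 1), x i := by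
    intro j hj
    rw [shiftedFactor, Finset.sum_eq_zero (s := Finset.Ico (j + 1) (m + 1)), mul_zero, add_zero]
    intro k hk
    rw [Finset.mem_Ico] at hk
    have := hhigh k (by omega) (by omega)
    exact if_neg (by omega)
  have htel : ∀ s, 1 ≤ s → s ≤ t → ∏ j ∈ Finset.Ico 1 s, shiftedFactor c x y (m + 1) j *
      (∑ i ∈ Finset.range (c j), x i) / ∑ i ∈ Finset.range (j + 1), x i =
      x 0 * (∏ j ∈ Finset.Ico 1 s, shiftedFactor c x y (m + 1) j) / ∑ i ∈ Finset.range s, x i := by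
    intro s hs
    induction s, hs using Nat.le_induction with
    | base =>
      intro _
      have := hx 1 le_rfl
      simp only [Finset.range_one, Finset.sum_singleton] at this
      simp [this]
    | succ s hs ih =>
      intro hst
      have h1 := hx s hs
      rw [Finset.prod_Ico_succ_top hs, Finset.prod_Ico_succ_top hs, ih (by omega),
        hlow s hs (by omega)]
      field_simp
  have htail : ∏ j ∈ Finset.Ico (t + 1) (m + 1), shiftedFactor c x y (m + 1) j *
      (∑ i ∈ Finset.range (c j), x i) / ∑ i ∈ Finset.range (j + 1), x i =
      (∏ j ∈ Finset.Ico (t + 1) (m + 1), y j) *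
        ∏ j ∈ Finset.Ico (t + 1) (m + 1), ∑ i ∈ Finset.range (c j), x i := by
    rw [← Finset.prod_mul_distrib]
    refine Finset.prod_congr rfl fun j hj => ?_
    rw [Finset.mem_Ico] at hj
    rw [hf j (by omega)]
    have := hx (j + 1) (by omega)
    field_simp
  have h1 := hx t ht0
  have h2 := hx (t + 1) (by omega)
  rw [det_shiftedLaplacian_eq_prod hx hc, ← Finset.prod_Ico_consecutive _ ht0 (by omega),
    htel t ht0 le_rfl, Finset.prod_eq_prod_Ico_succ_bot (show t < m + 1 by omega), htail, hf t le_rfl,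
    hlow t ht0 le_rfl, shiftedProduct,
    Finset.prod_eq_prod_Ico_succ_bot (show t < m + 1 by omega) y]
  field_simp

section Map

variable {B : Type*} [CommRing B] (φ : A →+* B) (c : ℕ → ℕ) (x y : ℕ → A)

lemma map_shiftedWeight (i j : ℕ) :
    φ (shiftedWeight c x y i j) = shiftedWeight c (φ ∘ x) (φ ∘ y) i j := by
  simp only [shiftedWeight, Function.comp_apply]
  split_ifs <;> simp

lemma map_det_shiftedLaplacian (m : ℕ) :
    φ (shiftedLaplacian c x y m).det = (shiftedLaplacian c (φ ∘ x) (φ ∘ y) m).det := by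
  rw [RingHom.map_det]
  congr 1
  ext a b
  simp only [shiftedLaplacian, RingHom.mapMatrix_apply, Matrix.map_apply, Matrix.of_apply, map_sub,
    map_shiftedWeight]
  split_ifs <;> simp [map_shiftedWeight]

lemma map_shiftedProduct (n t : ℕ) :
    φ (shiftedProduct c x y n t) = shiftedProduct c (φ ∘ x) (φ ∘ y) n t := by
  simp only [shiftedProduct, shiftedFactor, map_mul, map_prod, map_add, map_sum,
    Function.comp_apply, apply_ite φ, map_zero]

end Map

theorem det_shiftedLaplacian {c : ℕ → ℕ} (x y : ℕ → A) {m t : ℕ} (hc : IsLowerDegree c (m + 1))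
    (ht0 : 1 ≤ t) (htm : t ≤ m) (hlow : ∀ j, 1 ≤ j → j ≤ t → c j = j)
    (hhigh : ∀ j, t < j → j ≤ m → c j ≤ t) :
    (shiftedLaplacian c x y m).det = shiftedProduct c x y (m + 1) t := by
  let X : ℕ → MvPolynomial (ℕ ⊕ ℕ) ℤ := fun i => MvPolynomial.X (Sum.inl i)
  let Y : ℕ → MvPolynomial (ℕ ⊕ ℕ) ℤ := fun i => MvPolynomial.X (Sum.inr i)
  have hX : ∀ k, 1 ≤ k → ∑ i ∈ Finset.range k, X i ≠ 0 := by
    intro k hk h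
    have h2 := congrArg (MvPolynomial.eval fun s : ℕ ⊕ ℕ => if s = Sum.inl 0 then (1 : ℤ) else 0) h
    simp [X] at h2
    omega
  have huniv : (shiftedLaplacian c X Y m).det = shiftedProduct c X Y (m + 1) t := by
    let ι := algebraMap (MvPolynomial (ℕ ⊕ ℕ) ℤ) (FractionRing (MvPolynomial (ℕ ⊕ ℕ) ℤ))
    have hι : Function.Injective ι := IsFractionRing.injective _ _
    apply hι
    rw [map_det_shiftedLaplacian, map_shiftedProduct]
    refine det_shiftedLaplacian_of_field (fun k hk => ?_) hc ht0 htm hlow hhigh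
    have := (map_ne_zero_iff ι hι).2 (hX k hk)
    rwa [map_sum] at this
  let φ : MvPolynomial (ℕ ⊕ ℕ) ℤ →+* A :=
    MvPolynomial.eval₂Hom (Int.castRingHom A) (Sum.elim x y)
  have hφX : φ ∘ X = x := by ext i; simp [φ, X]
  have hφY : φ ∘ Y = y := by ext i; simp [φ, Y]
  have := congrArg φ huniv
  rwa [map_det_shiftedLaplacian, map_shiftedProduct, hφX, hφY] at this

end ClosedForm
section EdgeProduct

variable {V A : Type*} [CommRing A] {n : ℕ}

lemma minMaxWeight_of_lt (v : Fin n ≃ V) (x y : Fin n → A) {i j : Fin n} (hij : i < j) :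
    minMaxWeight v x y s(v i, v j) = x i * y j := by
  simp [minMaxWeight, inf_eq_left.2 hij.le, sup_eq_right.2 hij.le]

open scoped Classical in
/-- The weight of a graph is determined by its indegrees and outdegrees. -/
lemma prod_minMaxWeight [Fintype V] (T : SimpleGraph V) (v : Fin n ≃ V) (x y : Fin n → A) :
    ∏ e ∈ T.edgeFinset, minMaxWeight v x y e =
      ∏ i : Fin n, x i ^ indeg T v i * y i ^ outdeg T v i := by
  have hedge : ∏ e ∈ T.edgeFinset, minMaxWeight v x y e =
      ∏ p : Fin n × Fin n with p.1 < p.2 ∧ T.Adj (v p.1) (v p.2), x p.1 * y p.2 := by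
    symm
    refine Finset.prod_bij (fun p _ => s(v p.1, v p.2)) ?_ ?_ ?_ ?_
    · rintro ⟨i, j⟩ h
      simpa using (Finset.mem_filter.1 h).2.2
    · rintro ⟨i, j⟩ h ⟨k, l⟩ h' he
      have h1 : i < j := (Finset.mem_filter.1 h).2.1
      have h2 : k < l := (Finset.mem_filter.1 h').2.1
      rcases Sym2.eq_iff.1 he with ⟨ha, hb⟩ | ⟨ha, hb⟩
      · exact Prod.ext (v.injective ha) (v.injective hb)
      · have ha' : i = l := v.injective ha
        have hb' : j = k := v.injective hb
        omega
    · intro e he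
      induction e using Sym2.ind with
      | _ a b =>
        rw [SimpleGraph.mem_edgeFinset, SimpleGraph.mem_edgeSet] at he
        rcases lt_trichotomy (v.symm a) (v.symm b) with h | h | h
        · exact ⟨(v.symm a, v.symm b), by simp [h, he], by simp⟩
        · exact absurd (v.symm.injective h) he.ne
        · exact ⟨(v.symm b, v.symm a), by simp [h, he.symm], by simp [Sym2.eq_swap]⟩
    · rintro ⟨i, j⟩ h
      exact (minMaxWeight_of_lt v x y (Finset.mem_filter.1 h).2.1).symm
  rw [hedge, Finset.prod_mul_distrib, Finset.prod_mul_distrib]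
  congr 1
  · rw [Finset.prod_filter, Fintype.prod_prod_type]
    refine Finset.prod_congr rfl fun i _ => ?_
    rw [← Finset.prod_filter]
    dsimp only
    rw [Finset.prod_const, indeg, Set.ncard_eq_toFinset_card']
    simp
  · rw [Finset.prod_filter, Fintype.prod_prod_type_right]
    refine Finset.prod_congr rfl fun i _ => ?_
    rw [← Finset.prod_filter]
    dsimp only
    rw [Finset.prod_const, outdeg, Set.ncard_eq_toFinset_card']
    simp [T.adj_comm (v i)]

end EdgeProduct

section LowerDegree

lemma mem_iff_lt_card_of_isLowerSet {n : ℕ} {S : Finset (Fin n)}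
    (hS : ∀ i ∈ S, ∀ j < i, j ∈ S) (i : Fin n) : i ∈ S ↔ i.val < S.card := by
  constructor
  · intro hi
    have : Finset.Iic i ⊆ S := fun j hj => by
      rcases (Finset.mem_Iic.1 hj).lt_or_eq with h | rfl
      · exact hS i hi j h
      · exact hi
    have := Finset.card_le_card this
    rw [Fin.card_Iic] at this
    omega
  · intro hi
    by_contra hiS
    have : S ⊆ Finset.Iio i := fun j hj => Finset.mem_Iio.2 (by
      by_contra hji
      rcases (not_lt.1 hji).lt_or_eq with h | rfl
      · exact hiS (hS j hj i h)
      · exact hiS hj)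
    have := Finset.card_le_card this
    rw [Fin.card_Iio] at this
    omega

variable {V : Type*} {n : ℕ} {G : SimpleGraph V} {v : Fin n ≃ V}

open scoped Classical in
/-- The number of neighbours of `v k` of smaller index. -/
noncomputable def lowerDegree (G : SimpleGraph V) (v : Fin n ≃ V) (k : ℕ) : ℕ :=
  if h : k < n then
    (Finset.univ.filter fun i : Fin n => i < ⟨k, h⟩ ∧ G.Adj (v i) (v ⟨k, h⟩)).card
  else 0

lemma IsThresholdOrdering.adj_iff (hv : IsThresholdOrdering G v) {i k : Fin n} (hik : i < k) :
    G.Adj (v i) (v k) ↔ i.val < lowerDegree G v k := by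
  classical
  rw [lowerDegree, dif_pos k.2, Fin.eta, ← mem_iff_lt_card_of_isLowerSet]
  · simp [hik]
  · intro a ha b hb
    simp only [Finset.mem_filter, Finset.mem_univ, true_and] at ha ⊢
    exact ⟨hb.trans ha.1, (hv a k ha.1 ha.2).1 b hb⟩

lemma lowerDegree_le (G : SimpleGraph V) (v : Fin n ≃ V) (k : ℕ) : lowerDegree G v k ≤ k := by
  classical
  rw [lowerDegree]
  split_ifs with h
  · have : (Finset.univ.filter fun i : Fin n => i < ⟨k, h⟩ ∧ G.Adj (v i) (v ⟨k, h⟩)) ⊆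
        Finset.Iio ⟨k, h⟩ := fun i hi => Finset.mem_Iio.2 (Finset.mem_filter.1 hi).2.1
    exact (Finset.card_le_card this).trans_eq (Fin.card_Iio _)
  · exact Nat.zero_le k

lemma IsThresholdOrdering.adj_zero (hv : IsThresholdOrdering G v) (hG : G.Connected)
    {o k : Fin n} (ho : o.val = 0) (hk : o < k) : G.Adj (v o) (v k) := by
  have : Nontrivial V := ⟨v o, v k, fun h => hk.ne (v.injective h)⟩
  obtain ⟨u, hu⟩ := hG.preconnected.exists_adj_of_nontrivial (v k)
  obtain ⟨j, rfl⟩ := v.surjective u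
  rcases lt_trichotomy j k with h | rfl | h
  · by_cases hj : o = j
    · rw [hj]; exact hu.symm
    · exact (hv j k h hu.symm).1 o (by omega)
  · exact absurd rfl hu.ne
  · exact ((hv k j h hu).2 o (hk.trans h) hk.ne).symm

lemma IsThresholdOrdering.isLowerDegree (hv : IsThresholdOrdering G v) (hG : G.Connected) :
    IsLowerDegree (lowerDegree G v) n where
  pos k h1 hk := (hv.adj_iff (i := ⟨0, by omega⟩) (k := ⟨k, hk⟩) h1).1
    (hv.adj_zero hG rfl (Fin.mk_lt_mk.2 h1))
  le k _ := lowerDegree_le G v k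
  min_le k l hkl hl := by
    by_contra! h
    have h1 : lowerDegree G v k < k := by omega
    have h2 := (hv.adj_iff (i := ⟨lowerDegree G v k, by omega⟩) (k := ⟨l, hl⟩)
      (Fin.mk_lt_mk.2 (by omega))).2 (show lowerDegree G v k < lowerDegree G v l by omega)
    have h3 := (hv _ _ (Fin.mk_lt_mk.2 (by omega)) h2).2 ⟨k, by omega⟩
      (Fin.mk_lt_mk.2 hkl) (by simp only [ne_eq, Fin.mk.injEq]; omega)
    have h4 := (hv.adj_iff (Fin.mk_lt_mk.2 h1)).1 h3
    exact lt_irrefl _ h4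

variable {t : Fin n}

lemma IsSpecialIndex.pos (ht : IsSpecialIndex G v t) (hv : IsThresholdOrdering G v)
    (hG : G.Connected) (hn : 2 ≤ n) : 1 ≤ t.val := by
  have h : (⟨1, hn⟩ : Fin n) ≤ t := ht.2 fun i j hij hj => by
    have hj' : j.val ≤ 1 := hj
    have h1 : i.val = 0 := by omega
    exact hv.adj_zero hG h1 hij
  exact h

lemma IsSpecialIndex.lowerDegree_eq (ht : IsSpecialIndex G v t) (hv : IsThresholdOrdering G v)
    {j : ℕ} (hj : j ≤ t) : lowerDegree G v j = j := by
  refine (lowerDegree_le G v j).antisymm (not_lt.1 fun h => ?_)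
  have hjn : j < n := by omega
  have h1 := ht.1 ⟨lowerDegree G v j, by omega⟩ ⟨j, hjn⟩ (Fin.mk_lt_mk.2 h) hj
  exact lt_irrefl _ ((hv.adj_iff (Fin.mk_lt_mk.2 h)).1 h1)

lemma IsSpecialIndex.lowerDegree_le (ht : IsSpecialIndex G v t) (hv : IsThresholdOrdering G v)
    {j : ℕ} (htj : t < j) (hj : j < n) : lowerDegree G v j ≤ t := by
  by_contra! h
  have h1 := (hv.adj_iff (i := t) (k := ⟨j, hj⟩) htj).2 h
  have hs : t.val + 1 < n := by omega
  have hts : t < (⟨t + 1, hs⟩ : Fin n) := Nat.lt_succ_self t.val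
  have h2 : G.Adj (v t) (v ⟨t + 1, hs⟩) := by
    rcases (show t.val + 1 ≤ j from htj).lt_or_eq with h3 | h3
    · exact (hv t ⟨j, hj⟩ htj h1).2 ⟨t + 1, hs⟩ h3 hts.ne'
    · simp only [h3]; exact h1
  have h3 : (⟨t + 1, hs⟩ : Fin n) ≤ t := ht.2 fun a b hab hb => by
    rcases hb.lt_or_eq with hb | rfl
    · exact ht.1 a b hab (Nat.lt_succ_iff.1 hb)
    · rcases (show a ≤ t from Nat.lt_succ_iff.1 hab).lt_or_eq with ha | rfl
      · exact (hv t _ hts h2).1 a ha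
      · exact h2
  exact absurd hts h3.not_gt

variable [Fintype V] [DecidableRel G.Adj]

lemma degree_eq_card (v : Fin n ≃ V) (j : Fin n) :
    G.degree (v j) = (Finset.univ.filter fun k : Fin n => G.Adj (v j) (v k)).card := by
  rw [← SimpleGraph.card_neighborFinset_eq_degree, ← Finset.card_map v.toEmbedding]
  congr 1
  ext u
  obtain ⟨k, rfl⟩ := v.surjective u
  simp

lemma IsSpecialIndex.le_degree_iff (ht : IsSpecialIndex G v t) (hv : IsThresholdOrdering G v)
    {j k : Fin n} (hj : j ≤ t) (hjk : j < k) :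
    k.val ≤ G.degree (v j) ↔ j.val < lowerDegree G v k := by
  classical
  rw [← hv.adj_iff hjk, degree_eq_card, ← Nat.lt_succ_iff]
  set S := Finset.univ.filter fun k : Fin n => G.Adj (v j) (v k) with hS
  have hjS : j ∉ S := by simp [hS]
  rw [← Nat.add_one, ← Finset.card_insert_of_notMem hjS, ← mem_iff_lt_card_of_isLowerSet]
  · simp [hS, hjk.ne']
  · intro a ha b hb
    rw [Finset.mem_insert] at ha ⊢
    by_cases hbj : b = j
    · exact Or.inl hbj
    refine Or.inr ?_
    have hadj : G.Adj (v j) (v b) := by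
      rcases lt_or_gt_of_ne hbj with h | h
      · exact (ht.1 b j h hj).symm
      · rcases ha with rfl | ha
        · exact absurd hb h.not_gt
        · exact (hv j a (h.trans hb) (by simpa [hS] using ha)).2 b hb hbj
    simpa [hS] using hadj

lemma IsSpecialIndex.degree_eq (ht : IsSpecialIndex G v t) (hv : IsThresholdOrdering G v)
    {j : Fin n} (hj : t < j) : G.degree (v j) = lowerDegree G v j := by
  classical
  rw [degree_eq_card, lowerDegree, dif_pos j.2]
  congr 1
  ext k
  simp only [Finset.mem_filter, Finset.mem_univ, true_and, Fin.eta, G.adj_comm (v k), iff_and_self]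
  intro h
  by_contra hkj
  rcases (not_lt.1 hkj).lt_or_eq with h1 | rfl
  · have h2 := (hv.adj_iff h1).1 h
    have h3 := ht.lowerDegree_le hv (hj.trans h1) k.2
    omega
  · exact h.ne rfl

end LowerDegree
@[to_additive]
lemma prod_fin_eq_prod_nat {M : Type*} [CommMonoid M] {n : ℕ} (F : ℕ → M) {s : Finset (Fin n)}
    {s' : Finset ℕ} (h : ∀ k, k ∈ s' ↔ ∃ hk : k < n, (⟨k, hk⟩ : Fin n) ∈ s) :
    ∏ i ∈ s, F i = ∏ k ∈ s', F k := by
  have : s' = s.map Fin.valEmbedding := by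
    ext k
    rw [h, Finset.mem_map]
    constructor
    · rintro ⟨hk, hs⟩
      exact ⟨⟨k, hk⟩, hs, rfl⟩
    · rintro ⟨i, hi, rfl⟩
      exact ⟨i.2, hi⟩
  rw [this, Finset.prod_map]
  rfl

/-- Extension by zero of a finite sequence. -/
def extendZero {A : Type*} [Zero A] {n : ℕ} (x : Fin n → A) (k : ℕ) : A :=
  if h : k < n then x ⟨k, h⟩ else 0

@[simp]
lemma extendZero_val {A : Type*} [Zero A] {n : ℕ} (x : Fin n → A) (i : Fin n) :
    extendZero x i = x i := by
  simp [extendZero]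

variable {V : Type*} {A : Type*} [CommRing A] {n : ℕ} {G : SimpleGraph V} {t : Fin n}

open scoped Classical in
lemma IsThresholdOrdering.weight_eq {v : Fin n ≃ V} (hv : IsThresholdOrdering G v)
    (x y : Fin n → A) (i j : Fin n) :
    (if G.Adj (v i) (v j) then minMaxWeight v x y s(v i, v j) else 0) =
      shiftedWeight (lowerDegree G v) (extendZero x) (extendZero y) i j := by
  have key : ∀ {i j : Fin n}, i < j →
      (if G.Adj (v i) (v j) then minMaxWeight v x y s(v i, v j) else 0) =
        shiftedWeight (lowerDegree G v) (extendZero x) (extendZero y) i j := by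
    intro i j hij
    have hij' : i.val ≤ j := hij.le
    rw [shiftedWeight, min_eq_left hij', max_eq_right hij', minMaxWeight_of_lt v x y hij,
      extendZero_val, extendZero_val]
    simp only [hv.adj_iff hij]
  rcases lt_trichotomy i j with h | rfl | h
  · exact key h
  · rw [if_neg (G.loopless.irrefl _), shiftedWeight, min_self, max_self,
      if_neg (lowerDegree_le G v i).not_gt]
  · rw [shiftedWeight_comm, ← key h, Sym2.eq_swap]
    simp only [G.adj_comm (v i)]

lemma IsThresholdOrdering.treeEnumerator_eq_det [Fintype V] {m : ℕ} {v : Fin (m + 1) ≃ V}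
    (hv : IsThresholdOrdering G v) (x y : Fin (m + 1) → A) :
    treeEnumerator G (minMaxWeight v x y) =
      (shiftedLaplacian (lowerDegree G v) (extendZero x) (extendZero y) m).det := by
  classical
  rw [ThresholdTree.treeEnumerator_eq_det G _ (v 0)]
  let e : Fin m ≃ {i : V // i ≠ v 0} := Equiv.ofBijective
    (fun a => ⟨v a.succ, fun h => Fin.succ_ne_zero a (v.injective h)⟩)
    ⟨fun a b hab => Fin.succ_injective _ (v.injective (congrArg Subtype.val hab)), by
      rintro ⟨u, hu⟩
      obtain ⟨k, rfl⟩ := v.surjective u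
      obtain ⟨a, rfl⟩ := Fin.exists_succ_eq.2 fun h => hu (congrArg v h)
      exact ⟨a, rfl⟩⟩
  rw [← Matrix.det_submatrix_equiv_self e]
  congr 1
  ext a b
  have hsum : ∑ k : V, (if G.Adj (v a.succ) k then minMaxWeight v x y s(v a.succ, k) else 0) =
      ∑ k ∈ Finset.range (m + 1),
        shiftedWeight (lowerDegree G v) (extendZero x) (extendZero y) (a + 1) k := by
    rw [← Equiv.sum_comp v, ← Fin.sum_univ_eq_sum_range]
    exact Finset.sum_congr rfl fun k _ => hv.weight_eq x y a.succ k
  have hoff := hv.weight_eq x y a.succ b.succ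
  rw [Fin.val_succ, Fin.val_succ] at hoff
  simp only [Matrix.submatrix_apply, reducedLaplacian, shiftedLaplacian, Matrix.of_apply,
    e.injective.eq_iff]
  change (if a = b then ∑ k : V, (if G.Adj (v a.succ) k then
    minMaxWeight v x y s(v a.succ, k) else 0) else 0) - (if G.Adj (v a.succ) (v b.succ) then
    minMaxWeight v x y s(v a.succ, v b.succ) else 0) = _
  rw [hsum, hoff]

variable [Fintype V] [DecidableRel G.Adj] {v : Fin n ≃ V} {δ : Fin n → ℕ}

lemma IsSpecialIndex.fFactor_eq (ht : IsSpecialIndex G v t) (hv : IsThresholdOrdering G v)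
    (hδ : ∀ i, δ i = G.degree (v i)) (x y : Fin n → A) {j : Fin n} (hj : j ≤ t) :
    fFactor δ x y j = shiftedFactor (lowerDegree G v) (extendZero x) (extendZero y) n j := by
  rw [fFactor, shiftedFactor, extendZero_val, extendZero_val, ← Finset.sum_filter]
  congr 2
  · rw [← sum_fin_eq_sum_nat (extendZero x) (s := Finset.Iic j)]
    · simp
    · intro k
      simp only [Finset.mem_range, Finset.mem_Iic, Fin.le_def, exists_prop]
      omega
  · rw [← sum_fin_eq_sum_nat (extendZero y)
      (s := Finset.univ.filter fun k : Fin n => j < k ∧ k.val ≤ δ j)]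
    · simp
    · intro k
      simp only [Finset.mem_filter, Finset.mem_Ico, Finset.mem_univ, true_and]
      constructor
      · rintro ⟨⟨h1, h2⟩, h3⟩
        exact ⟨h2, h1, by rw [hδ]; exact (ht.le_degree_iff hv (k := ⟨k, h2⟩) hj h1).2 h3⟩
      · rintro ⟨h2, h1, h3⟩
        rw [hδ] at h3
        exact ⟨⟨h1, h2⟩, (ht.le_degree_iff hv (k := ⟨k, h2⟩) hj h1).1 h3⟩

lemma IsSpecialIndex.gFactor_eq (ht : IsSpecialIndex G v t) (hv : IsThresholdOrdering G v)
    (hδ : ∀ i, δ i = G.degree (v i)) (x : Fin n → A) {j : Fin n} (hj : t < j) :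
    gFactor δ x j = ∑ i ∈ Finset.range (lowerDegree G v j), extendZero x i := by
  have hle := ThresholdTree.lowerDegree_le G v j
  rw [gFactor, hδ, ht.degree_eq hv hj, ← sum_fin_eq_sum_nat (extendZero x)
    (s := Finset.univ.filter fun i : Fin n => i.val < lowerDegree G v j)]
  · simp
  · intro k
    simp only [Finset.mem_filter, Finset.mem_range, Finset.mem_univ, true_and]
    exact ⟨fun h => ⟨by omega, h⟩, fun h => h.2⟩

lemma IsSpecialIndex.shiftedProduct_eq (ht : IsSpecialIndex G v t)
    (hv : IsThresholdOrdering G v) (hδ : ∀ i, δ i = G.degree (v i)) (x y : Fin n → A)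
    (hn : 0 < n) :
    shiftedProduct (lowerDegree G v) (extendZero x) (extendZero y) n t =
      x ⟨0, hn⟩ * (∏ i ∈ Finset.Ici t, y i) *
        (∏ j ∈ Finset.Ioo ⟨0, hn⟩ t, fFactor δ x y j) * (∏ j ∈ Finset.Ioi t, gFactor δ x j) := by
  rw [shiftedProduct]
  congr 1
  · congr 1
    · congr 1
      · exact extendZero_val x ⟨0, hn⟩
      · rw [← prod_fin_eq_prod_nat (extendZero y) (s := Finset.Ici t)]
        · simp
        · intro k
          simp only [Finset.mem_Ico, Finset.mem_Ici, Fin.le_def, exists_prop]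
          omega
    · rw [← prod_fin_eq_prod_nat _ (s := Finset.Ioo ⟨0, hn⟩ t)]
      · exact Finset.prod_congr rfl fun j hj =>
          (ht.fFactor_eq hv hδ x y (Finset.mem_Ioo.1 hj).2.le).symm
      · intro k
        simp only [Finset.mem_Ico, Finset.mem_Ioo, Fin.lt_def, exists_prop]
        omega
  · rw [← prod_fin_eq_prod_nat _ (s := Finset.Ioi t)]
    · exact Finset.prod_congr rfl fun j hj => (ht.gFactor_eq hv hδ x (Finset.mem_Ioi.1 hj)).symm
    · intro k
      simp only [Finset.mem_Ico, Finset.mem_Ioi, Fin.lt_def, exists_prop]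
      omega

end ThresholdTree

open ThresholdTree
theorem mainTheorem2 {V : Type*} [Fintype V] {R : Type*} [CommRing R]
    (n : ℕ) (hn : 2 ≤ n) (G : SimpleGraph V) [DecidableRel G.Adj] (v : Fin n ≃ V)
    (hG : G.Connected) (hv : IsThresholdOrdering G v)
    (δ : Fin n → ℕ) (hδ : ∀ i, δ i = G.degree (v i))
    (t : Fin n) (ht : IsSpecialIndex G v t)
    (x y : Fin n → MvPolynomial (Fin n ⊕ Fin n) R)
    (hx : ∀ i, x i = MvPolynomial.X (Sum.inl i)) (hy : ∀ i, y i = MvPolynomial.X (Sum.inr i)) :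
    treeEnumerator G (minMaxWeight v x y) =
        ∑ T ∈ spanningTrees G, ∏ i : Fin n, x i ^ indeg T v i * y i ^ outdeg T v i ∧
    ∑ T ∈ spanningTrees G, ∏ i : Fin n, x i ^ indeg T v i * y i ^ outdeg T v i =
      x ⟨0, by omega⟩ * (∏ i ∈ Finset.Ici t, y i) *
        (∏ j ∈ Finset.Ioo ⟨0, by omega⟩ t, fFactor δ x y j) *
        (∏ j ∈ Finset.Ioi t, gFactor δ x j) := by
  have h1 : treeEnumerator G (minMaxWeight v x y) =
      ∑ T ∈ spanningTrees G, ∏ i : Fin n, x i ^ indeg T v i * y i ^ outdeg T v i :=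
    Finset.sum_congr rfl fun T _ => prod_minMaxWeight T v x y
  refine ⟨h1, ?_⟩
  rw [← h1, ← ht.shiftedProduct_eq hv hδ x y (by omega)]
  obtain ⟨m, rfl⟩ : ∃ m, n = m + 1 := ⟨n - 1, by omega⟩
  rw [hv.treeEnumerator_eq_det]
  exact det_shiftedLaplacian _ _ (hv.isLowerDegree hG) (ht.pos hv hG hn) (by omega)
    (fun j _ hj => ht.lowerDegree_eq hv hj) fun j hj hjm => ht.lowerDegree_le hv hj (by omega)
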